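/- Let $R$ be a commutative noetherian ring. For a prime ideal $\mathfrak p$ of $R$ let $k(\mathfrak p)=(R/\mathfrak p)_{\mathfrak p}$, regarded as an $R$-module. Complexes of $R$-modules are graded cohomologically and may be unbounded in both directions, and for such complexes $N$ and $M$ we write $\operatorname{Ext}^i_R(N,M)=\operatorname{Hom}_{D(R)}(N,M[i])$, $i\in\mathbb Z$, where $D(R)$ is the derived category of $R$-modules and a module is viewed as a complex concentrated in degree $0$. A complex $I$ is semi-injective if every $I^i$ is an injective module and every morphism from an acyclic complex to $I$ is null-homotopic. We write $\operatorname{inj\,dim}_R M\le d$ if there is a quasi-isomorphism $M\to I$ with $I$ semi-injective and $I^i=0$ for all $i>d$. (1) Let $M$ be a complex of $R$-modules and $d$ an integer. If $\operatorname{Ext}^i_R(k(\mathfrak p),M)=0$ for every prime ideal $\mathfrak p$ of $R$ and all integers $i>d$, then $\operatorname{inj\,dim}_R M\le d$. (2) In particular, an $R$-module $M$ is injective if $\operatorname{Ext}^i_R(k(\mathfrak p),M)=0$ for every prime ideal $\mathfrak p$ of $R$ and all $i\ge 1$. -/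

import Mathlib

universe u

open CategoryTheory CategoryTheory.Limits

/-- For complexes `N`, `M` of modules over a commutative ring `R` (cohomological grading, no
boundedness), `cplxExt N M i` is `Ext^i_R(N, M) = Hom_{D(R)}(N, M[i])`, the homs being taken in
the derived category of `R`-modules. -/
noncomputable def cplxExt {R : Type u} [CommRing R]
    (N M : CochainComplex (ModuleCat.{u} R) ℤ) (i : ℤ) : Type (u + 1) :=
  letI := HasDerivedCategory.standard (ModuleCat.{u} R)
  ShiftedHom (DerivedCategory.Q.obj N) (DerivedCategory.Q.obj M) i

/-- The field `k(p) = (R/p)_p`, as an `R`-module. -/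
noncomputable abbrev residueModule (R : Type u) [CommRing R] (p : Ideal R) [p.IsPrime] :
    ModuleCat.{u} R :=
  ModuleCat.of R p.ResidueField

/-- A semi-injective (also called DG-injective) complex: a complex of injective modules such that
every morphism from an acyclic complex to it is null-homotopic. -/
structure IsSemiInjective {R : Type u} [CommRing R]
    (I : CochainComplex (ModuleCat.{u} R) ℤ) : Prop where
  injective : ∀ i : ℤ, Injective (I.X i)
  isKInjective : I.IsKInjective

/-- The injective dimension of the complex `M` is at most `d`: there is a semi-injective
resolution `M ⟶ I`, i.e. a quasi-isomorphism to a semi-injective complex, with `I^i = 0` for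
all `i > d`. -/
def HasInjDimLE {R : Type u} [CommRing R]
    (M : CochainComplex (ModuleCat.{u} R) ℤ) (d : ℤ) : Prop :=
  ∃ (I : CochainComplex (ModuleCat.{u} R) ℤ) (f : M ⟶ I),
    IsSemiInjective I ∧ QuasiIso f ∧ ∀ i : ℤ, d < i → IsZero (I.X i)

/-! Let `I` be a semi-injective resolution of `M`. For a module `N`, vanishing of Ext in degree `b`
says that every cocycle `N ⟶ I.X b` lifts along the differential into `I.X b`; `LiftsCocycles` is
this condition.

The hypothesis passes from residue fields to all modules by noetherian induction on primes
(`liftsCocycles_of_residueField`). Assume vanishing in all degrees above `d` for `R ⧸ q`, all primes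
`q ⊋ p`. Every nonzero quotient of k(p)/(R/p) contains a copy of some such `R ⧸ q`, so an Eklof-type
argument (`LiftsCocycles.of_quotients`) gives vanishing for k(p)/(R/p). As Ext^i(R/p) sits between
Ext^i(k(p)) and Ext^{i+1}(k(p)/(R/p)), it vanishes too (`LiftsCocycles.of_exact`). Since every
nonzero module contains some `R ⧸ q`, the Eklof argument then covers all modules.

Applied to the modules of cocycles of `I`, this splits `I` above degree `d`, so `I` is homotopy
equivalent to its truncation in degrees at most `d`, whose terms are injective
(`exists_homotopyEquiv_of_lifts`). -/

/-! ### Limits of towers. -/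

/-- `L` with the projections `π n` is the limit of the tower `⋯ ⟶ X 2 ⟶ X 1 ⟶ X 0`. -/
structure IsTowerLimit {C : Type*} [Category C] {X : ℕ → C} (p : ∀ n, X (n + 1) ⟶ X n)
    {L : C} (π : ∀ n, L ⟶ X n) : Prop where
  w : ∀ n, π (n + 1) ≫ p n = π n
  hom_ext : ∀ {B : C} {f g : B ⟶ L}, (∀ n, f ≫ π n = g ≫ π n) → f = g
  exists_lift : ∀ {B : C} (b : ∀ n, B ⟶ X n), (∀ n, b (n + 1) ≫ p n = b n) →
    ∃ l : B ⟶ L, ∀ n, l ≫ π n = b n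

namespace IsTowerLimit

variable {C : Type*} [Category C]

lemma of_isLimit {F : ℕᵒᵖ ⥤ C} {c : Cone F} (hc : IsLimit c) :
    IsTowerLimit (X := fun n ↦ F.obj (.op n)) (fun n ↦ F.map (homOfLE n.le_succ).op)
      (fun n ↦ c.π.app (.op n)) where
  w n := c.w _
  hom_ext h := hc.hom_ext fun n ↦ h n.unop
  exists_lift {B} b hb := by
    let t : Cone F :=
      { pt := B
        π := NatTrans.ofOpSequence b (fun n ↦ (Category.id_comp _).trans (hb n).symm) }
    exact ⟨hc.lift t, fun n ↦ hc.fac t _⟩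

variable {X : ℕ → C} {p : ∀ n, X (n + 1) ⟶ X n} {L : C} {π : ∀ n, L ⟶ X n}

lemma shift (h : IsTowerLimit p π) :
    IsTowerLimit (fun n ↦ p (n + 1)) (fun n ↦ π (n + 1)) where
  w n := h.w _
  hom_ext hfg := h.hom_ext fun n ↦ by
    rw [← h.w, ← Category.assoc, hfg, Category.assoc]
  exists_lift {B} b hb := by
    obtain ⟨l, hl⟩ := h.exists_lift (fun n ↦ Nat.casesOn n (b 0 ≫ p 0) b) (fun n ↦ by
      cases n with
      | zero => rfl
      | succ n => exact hb n)
    exact ⟨l, fun n ↦ hl (n + 1)⟩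

/-- Morphisms to the terms of a tower which can be lifted step by step assemble into a morphism to
the limit. -/
lemma exists_lift_of_step (h : IsTowerLimit p π) {B : C} (P : ∀ n, (B ⟶ X n) → Prop)
    (b₀ : B ⟶ X 0) (h₀ : P 0 b₀) (step : ∀ n b, P n b → ∃ b', P (n + 1) b' ∧ b' ≫ p n = b) :
    ∃ l : B ⟶ L, l ≫ π 0 = b₀ ∧ ∀ n, P n (l ≫ π n) := by
  choose next hP hnext using step
  let s : ∀ n, { b : B ⟶ X n // P n b } := fun n ↦
    Nat.rec ⟨b₀, h₀⟩ (fun n b ↦ ⟨next n b.1 b.2, hP _ _ b.2⟩) n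
  obtain ⟨l, hl⟩ := h.exists_lift (fun n ↦ (s n).1) (fun n ↦ hnext n _ (s n).2)
  exact ⟨l, hl 0, fun n ↦ by rw [hl]; exact (s n).2⟩

lemma hasLiftingProperty (h : IsTowerLimit p π) {A B : C} (i : A ⟶ B)
    (hp : ∀ n, HasLiftingProperty i (p n)) : HasLiftingProperty i (π 0) where
  sq_hasLift {t b} sq := by
    obtain ⟨l, hl, hl'⟩ := h.exists_lift_of_step (fun n b ↦ i ≫ b = t ≫ π n) b
      sq.w.symm (fun n b hb ↦ by
        have sq' : CommSq (t ≫ π (n + 1)) i (p n) b := ⟨by rw [hb, Category.assoc, h.w]⟩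
        exact ⟨sq'.lift, sq'.fac_left, sq'.fac_right⟩)
    exact ⟨⟨l, h.hom_ext fun n ↦ by rw [Category.assoc, hl' n], hl⟩⟩

end IsTowerLimit

lemma CochainComplex.exists_isTowerLimit {C : Type*} [Category C] [Abelian C]
    [HasLimitsOfShape ℕᵒᵖ C] {X : ℕ → CochainComplex C ℤ} (p : ∀ n, X (n + 1) ⟶ X n) :
    ∃ (L : CochainComplex C ℤ) (π : ∀ n, L ⟶ X n), IsTowerLimit p π ∧
      ∀ i, IsTowerLimit (fun n ↦ (p n).f i) (fun n ↦ (π n).f i) := by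
  let F := Functor.ofOpSequence p
  have hF : (fun n ↦ F.map (homOfLE (Nat.le_succ n)).op) = p :=
    funext (Functor.ofOpSequence_map_homOfLE_succ p)
  have h := IsTowerLimit.of_isLimit (limit.isLimit F)
  have h' (i : ℤ) := IsTowerLimit.of_isLimit
    (isLimitOfPreserves (HomologicalComplex.eval C (.up ℤ) i) (limit.isLimit F))
  refine ⟨limit F, fun n ↦ limit.π F (.op n), ?_, fun i ↦ ?_⟩
  · rw [← hF]
    exact h
  · rw [← hF]
    exact h' i

/-! ### Lifting properties and K-injectivity. -/

namespace CochainComplex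

open HomologicalComplex HomComplex

variable {C : Type*} [Category C] [Abelian C]

/-- A degreewise epimorphism with injective kernel between bounded below complexes has the right
lifting property against all monomorphisms which are quasi-isomorphisms. -/
lemma degreewiseEpiWithInjectiveKernel.hasLiftingProperty {X Y : CochainComplex C ℤ} {p : X ⟶ Y}
    (hp : degreewiseEpiWithInjectiveKernel p) (d : ℤ) [X.IsStrictlyGE d]
    {A B : CochainComplex C ℤ} (i : A ⟶ B) [Mono i] [QuasiIso i] : HasLiftingProperty i p where
  sq_hasLift {t b} sq := by
    have sq' (n : ℤ) : CommSq (t.f n) (i.f n) (p.f n) (b.f n) :=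
      (sq.map (HomologicalComplex.eval _ _ n))
    have (n : ℤ) : (sq' n).HasLift := by
      have := (hp n).hasLiftingProperty (i.f n)
      infer_instance
    -- The failure of the degreewise lifts to commute with differentials is this cocycle; a
    -- primitive of it corrects them.
    let β : Cocycle (cokernel i) (kernel p) 1 :=
      Lifting.cocycle₁ sq (fun n ↦ ⟨(sq' n).lift, (sq' n).fac_left, (sq' n).fac_right⟩)
        (cokernelIsCokernel i) (kernelIsKernel p) (hπ := by simp) (hι := by simp)
    have (n : ℤ) : Injective ((kernel p).X n) :=
      Injective.of_iso
        (asIso (kernelComparison p (HomologicalComplex.eval _ _ n))).symm (hp n).2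
    have : (kernel p).IsStrictlyGE d := by
      rw [isStrictlyGE_iff]
      intro i hi
      rw [IsZero.iff_id_eq_zero, ← cancel_mono ((kernel.ι p).f i)]
      apply (X.isZero_of_isStrictlyGE d i).eq_of_tgt
    have : (kernel p).IsKInjective := isKInjective_of_injective _ d
    have hi : (cokernel i).Acyclic := by
      have : (ShortComplex.mk _ _ (cokernel.condition i)).ShortExact :=
        { exact := ShortComplex.exact_cokernel i }
      exact this.acyclic_X₃ (by dsimp; infer_instance)
    obtain ⟨α, hα⟩ := IsKInjective.eq_δ_of_cocycle β hi 0 (by simp)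
    exact Lifting.hasLift sq _ (cokernelIsCokernel _) (kernelIsKernel _) α hα

/-- A complex with the right lifting property against monomorphisms which are quasi-isomorphisms is
K-injective. -/
lemma isKInjective_of_hasLiftingProperty {L Z : CochainComplex C ℤ} (p : L ⟶ Z) (hZ : IsZero Z)
    (h : ∀ {A B : CochainComplex C ℤ} (i : A ⟶ B) [Mono i] [QuasiIso i],
      HasLiftingProperty i p) : L.IsKInjective where
  nonempty_homotopy_zero {A} f hA := by
    -- The cone of the identity is contractible, so a map that extends over it is null-homotopic.
    let i := mappingCone.inr (𝟙 A)
    have : Mono i := HomologicalComplex.mono_of_mono_f _ fun n ↦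
      mono_of_mono_fac (mappingCone.inr_f_snd_v (𝟙 A) n)
    have h0 := mappingCone.homotopyToZeroOfId A
    have hB : (mappingCone (𝟙 A)).Acyclic := fun n ↦ by
      rw [exactAt_iff_isZero_homology, IsZero.iff_id_eq_zero, ← homologyMap_id,
        h0.homologyMap_eq, homologyMap_zero]
    have : QuasiIso i := ⟨fun n ↦ by
      rw [quasiIsoAt_iff_isIso_homologyMap]
      exact isIso_of_source_target_iso_zero _
        ((hA n).isZero_homology).isoZero ((hB n).isZero_homology).isoZero⟩
    have := h i
    have sq : CommSq f i p 0 := ⟨hZ.eq_of_tgt _ _⟩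
    exact ⟨(Homotopy.ofEq (by rw [Category.id_comp, sq.fac_left])).symm.trans
      (((h0.compRight sq.lift).compLeft i).trans (.ofEq (by simp)))⟩

/-- One step of the construction of a semi-injective resolution. -/
lemma exists_tower_step [EnoughInjectives C] {M L : CochainComplex C ℤ} (φ : M ⟶ L) (n : ℤ)
    [L.IsStrictlyGE n] :
    ∃ (L' : CochainComplex C ℤ) (φ' : M ⟶ L') (p : L' ⟶ L), L'.IsStrictlyGE (n - 1) ∧
      (∀ j, n ≤ j → QuasiIsoAt φ' j) ∧ degreewiseEpiWithInjectiveKernel p ∧ φ' ≫ p = φ := by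
  have : L.IsStrictlyGE (n - 1) := L.isStrictlyGE_of_ge (n - 1) n (by lia)
  have : (M.truncGE n).IsStrictlyGE (n - 1 + 1) := by rw [sub_add_cancel]; infer_instance
  -- As `L` lives in degrees at least `n`, `φ` factors through `M.truncGE n`. Replacing that map by
  -- a fibration costs one more degree on the left.
  obtain ⟨L', hL', ι, π, _, _, hπ, fac⟩ := Plus.modelCategoryQuillen.cm5a
    (truncGEMap φ n ≫ inv (L.πTruncGE n)) (n - 1)
  refine ⟨L', M.πTruncGE n ≫ ι, π, hL', fun j hj ↦ ?_, hπ, ?_⟩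
  · have := M.quasiIsoAt_πTruncGE n j hj
    infer_instance
  · rw [Category.assoc, fac, πTruncGE_naturality_assoc, IsIso.hom_inv_id, Category.comp_id]

end CochainComplex

/-! ### Homology of tower limits and unbounded semi-injective resolutions. -/

namespace CochainComplex

open HomologicalComplex HomComplex

variable {C : Type*} [Category C] [Abelian C]

/-- Cocycles on a projective object lift along a degreewise epimorphism which is a quasi-isomorphism
in the given degree. -/
lemma exists_cocycle_lift {X Y : CochainComplex C ℤ} (p : X ⟶ Y) (i j k : ℤ) (hij : i + 1 = j)
    (hjk : j + 1 = k) [QuasiIsoAt p j] [Epi (p.f i)] {P : C} [Projective P] (y : P ⟶ Y.X j)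
    (hy : y ≫ Y.d j k = 0) : ∃ x : P ⟶ X.X j, x ≫ X.d j k = 0 ∧ x ≫ p.f j = y := by
  obtain ⟨A, π, _, x, hx, z, hz⟩ := (epi_homologyMap_iff_up_to_refinements p i j k
    (by simp; lia) (by simp; lia)).1 inferInstance y hy
  let s := Projective.factorThru (𝟙 P) π
  have hs : s ≫ π = 𝟙 P := Projective.factorThru_comp _ _
  let w := Projective.factorThru (s ≫ z) (p.f i)
  have hw : w ≫ p.f i = s ≫ z := Projective.factorThru_comp _ _
  refine ⟨s ≫ x + w ≫ X.d i j, by simp [hx], ?_⟩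
  rw [Preadditive.add_comp, Category.assoc, Category.assoc, ← p.comm, ← Category.assoc w, hw,
    Category.assoc, ← Preadditive.comp_add, ← hz, reassoc_of% hs]

/-- Injectivity on homology gives some primitive of `z`; its image differs from `y` by a cocycle,
which `exists_cocycle_lift` lifts so that it can be subtracted. -/
lemma exists_primitive_lift {X Y : CochainComplex C ℤ} (p : X ⟶ Y) (h i j k : ℤ)
    (hhi : h + 1 = i) (hij : i + 1 = j) (hjk : j + 1 = k) [QuasiIsoAt p i] [QuasiIsoAt p j]
    [Epi (p.f h)] {P : C} [Projective P] (z : P ⟶ X.X j) (hz : z ≫ X.d j k = 0) (y : P ⟶ Y.X i)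
    (hy : y ≫ Y.d i j = z ≫ p.f j) :
    ∃ x : P ⟶ X.X i, x ≫ X.d i j = z ∧ x ≫ p.f i = y := by
  obtain ⟨A, π, _, w, hw⟩ := (mono_homologyMap_iff_up_to_refinements p i j k
    (by simp; lia) (by simp; lia)).1 inferInstance z hz y hy.symm
  let s := Projective.factorThru (𝟙 P) π
  have hs : s ≫ π = 𝟙 P := Projective.factorThru_comp _ _
  have hsw : (s ≫ w) ≫ X.d i j = z := by rw [Category.assoc, ← hw, reassoc_of% hs]
  obtain ⟨c, hc, hc'⟩ := exists_cocycle_lift p h i j hhi hij ((s ≫ w) ≫ p.f i - y) (by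
    rw [Preadditive.sub_comp, hy, Category.assoc, p.comm, ← Category.assoc, hsw, sub_self])
  exact ⟨s ≫ w - c, by rw [Preadditive.sub_comp, hsw, hc, sub_zero],
    by rw [Preadditive.sub_comp, hc', sub_sub_cancel]⟩

/-- The projections from the limit of a tower of degreewise epimorphisms which are
quasi-isomorphisms in degrees `j - 1` and `j` are quasi-isomorphisms in degree `j`. -/
lemma quasiIsoAt_of_isTowerLimit [EnoughProjectives C] {X : ℕ → CochainComplex C ℤ}
    {p : ∀ n, X (n + 1) ⟶ X n} {L : CochainComplex C ℤ} {π : ∀ n, L ⟶ X n}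
    (hL : ∀ i, IsTowerLimit (fun n ↦ (p n).f i) (fun n ↦ (π n).f i)) (i j : ℤ) (hij : i + 1 = j)
    (hepi : ∀ n i, Epi ((p n).f i)) (hi : ∀ n, QuasiIsoAt (p n) i)
    (hj : ∀ n, QuasiIsoAt (p n) j) : QuasiIsoAt (π 0) j := by
  rw [quasiIsoAt_iff_isIso_homologyMap]
  have : Mono (homologyMap (π 0) j) := by
    rw [mono_homologyMap_iff_up_to_refinements _ i j (j + 1) (by simp; lia) (by simp)]
    intro A z hz y hy
    let q := Projective.π A
    -- Primitives are chosen compatibly along the tower, so they define one in the limit.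
    obtain ⟨l, -, hl⟩ := (hL i).exists_lift_of_step
      (fun n y ↦ y ≫ (X n).d i j = (q ≫ z) ≫ (π n).f j) (q ≫ y)
      (by rw [Category.assoc, Category.assoc, hy]) (fun n y hy ↦
        exists_primitive_lift (p n) (i - 1) i j (j + 1) (by lia) (by lia) rfl
          ((q ≫ z) ≫ (π (n + 1)).f j)
          (by rw [Category.assoc, Category.assoc, Hom.comm, reassoc_of% hz, zero_comp, comp_zero]) y
          (by rw [hy, Category.assoc _ _ ((p n).f j), (hL j).w]))
    refine ⟨_, q, inferInstance, l, (hL j).hom_ext fun n ↦ ?_⟩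
    rw [← hl n, Category.assoc, Category.assoc, Hom.comm]
  have : Epi (homologyMap (π 0) j) := by
    rw [epi_homologyMap_iff_up_to_refinements _ i j (j + 1) (by simp; lia) (by simp)]
    intro A y hy
    let q := Projective.π A
    obtain ⟨l, hl, hl'⟩ := (hL j).exists_lift_of_step (fun n y ↦ y ≫ (X n).d j (j + 1) = 0) (q ≫ y)
      (by rw [Category.assoc, hy, comp_zero])
      (fun n y hy ↦ exists_cocycle_lift (p n) i j (j + 1) (by lia) rfl y hy)
    refine ⟨_, q, inferInstance, l, (hL (j + 1)).hom_ext fun n ↦ ?_, 0, ?_⟩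
    · rw [Category.assoc, ← Hom.comm, ← Category.assoc, hl', zero_comp]
    · rw [zero_comp, add_zero, hl]
  exact isIso_of_mono_of_epi _

/-- Dropping the first `N` stages does not change the limit. -/
lemma quasiIsoAt_of_isTowerLimit_of_le [EnoughProjectives C] {X : ℕ → CochainComplex C ℤ}
    {p : ∀ n, X (n + 1) ⟶ X n} {L : CochainComplex C ℤ} {π : ∀ n, L ⟶ X n}
    (hL : ∀ i, IsTowerLimit (fun n ↦ (p n).f i) (fun n ↦ (π n).f i)) (i j : ℤ) (hij : i + 1 = j)
    (hepi : ∀ n i, Epi ((p n).f i)) (N : ℕ) (hi : ∀ n, N ≤ n → QuasiIsoAt (p n) i)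
    (hj : ∀ n, N ≤ n → QuasiIsoAt (p n) j) : QuasiIsoAt (π N) j := by
  induction N generalizing X L with
  | zero =>
    exact quasiIsoAt_of_isTowerLimit hL i j hij hepi (fun n ↦ hi n n.zero_le)
      (fun n ↦ hj n n.zero_le)
  | succ N ih =>
    exact ih (p := fun n ↦ p (n + 1)) (π := fun n ↦ π (n + 1)) (fun i ↦ (hL i).shift)
      (fun n i ↦ hepi (n + 1) i)
      (fun n hn ↦ hi (n + 1) (by lia)) (fun n hn ↦ hj (n + 1) (by lia))

/-- Unbounded complexes have semi-injective resolutions. -/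
theorem exists_isKInjective_resolution [EnoughProjectives C] [EnoughInjectives C]
    [HasLimitsOfShape ℕᵒᵖ C] (M : CochainComplex C ℤ) :
    ∃ (I : CochainComplex C ℤ) (f : M ⟶ I),
      (∀ i, Injective (I.X i)) ∧ I.IsKInjective ∧ QuasiIso f := by
  let T (n : ℕ) := { x : Σ L : CochainComplex C ℤ, M ⟶ L // x.1.IsStrictlyGE (-n : ℤ) }
  have step (n : ℕ) (x : T n) : ∃ (y : T (n + 1)) (p : y.1.1 ⟶ x.1.1),
      (∀ j, -(n : ℤ) ≤ j → QuasiIsoAt y.1.2 j) ∧ degreewiseEpiWithInjectiveKernel p ∧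
        y.1.2 ≫ p = x.1.2 := by
    have := x.2
    obtain ⟨L', φ', p, h₁, h₂, h₃, h₄⟩ := exists_tower_step x.1.2 (-n)
    exact ⟨⟨⟨L', φ'⟩, by convert h₁ using 1; push_cast; ring⟩, p, h₂, h₃, h₄⟩
  choose next p hφ hp fac using step
  obtain ⟨Z, hZ⟩ : ∃ Z : CochainComplex C ℤ, IsZero Z := ⟨_, isZero_zero _⟩
  -- Starting from zero turns lifting properties of `π 0` into injectivity and K-injectivity of the
  -- limit.
  let s : ∀ n, T n := fun n ↦ Nat.rec ⟨⟨Z, 0⟩, by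
    rw [isStrictlyGE_iff]; exact fun i _ ↦ (eval C (.up ℤ) i).map_isZero hZ⟩ next n
  let X (n : ℕ) : CochainComplex C ℤ := (s n).1.1
  let φ (n : ℕ) : M ⟶ X n := (s n).1.2
  let q (n : ℕ) : X (n + 1) ⟶ X n := p n (s n)
  have hX (n : ℕ) : (X n).IsStrictlyGE (-n : ℤ) := (s n).2
  have hq (n : ℕ) : degreewiseEpiWithInjectiveKernel (q n) := hp n (s n)
  have hφq (n : ℕ) : φ (n + 1) ≫ q n = φ n := fac n (s n)
  have hφ' (n : ℕ) (j : ℤ) (hj : -(n : ℤ) < j) : QuasiIsoAt (φ (n + 1)) j :=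
    hφ n (s n) j hj.le
  obtain ⟨L, π, hL, hL'⟩ := exists_isTowerLimit q
  obtain ⟨f, hf⟩ := hL.exists_lift φ hφq
  refine ⟨L, f, fun i ↦ ⟨fun {A B} g i' _ ↦ ?_⟩, ?_, ⟨fun j ↦ ?_⟩⟩
  · have := (hL' i).hasLiftingProperty i' (fun n ↦ (hq n i).hasLiftingProperty i')
    have sq : CommSq g i' ((π 0).f i) 0 :=
      ⟨((eval C (.up ℤ) i).map_isZero hZ).eq_of_tgt _ _⟩
    exact ⟨sq.lift, sq.fac_left⟩
  · exact isKInjective_of_hasLiftingProperty (π 0) hZ fun i _ _ ↦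
      hL.hasLiftingProperty i fun n ↦ by
        have := hX (n + 1)
        exact (hq n).hasLiftingProperty (-(n + 1 : ℕ)) i
  · let N := (2 - j).toNat + 1
    have hN (n : ℕ) (hn : N ≤ n) (i : ℤ) (hi : j - 1 ≤ i) : QuasiIsoAt (φ n) i := by
      obtain ⟨n, rfl⟩ : ∃ m, n = m + 1 := ⟨n - 1, by lia⟩
      exact hφ' n i (by lia)
    have hqN (n : ℕ) (hn : N ≤ n) (i : ℤ) (hi : j - 1 ≤ i) : QuasiIsoAt (q n) i := by
      have := hN n hn i hi
      have := hN (n + 1) (by lia) i hi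
      rwa [← quasiIsoAt_iff_comp_left (φ (n + 1)) (q n) i, hφq]
    have : QuasiIsoAt (π N) j :=
      quasiIsoAt_of_isTowerLimit_of_le hL' (j - 1) j (by lia) (fun n i ↦ (hq n i).1) N
        (fun n hn ↦ hqN n hn _ le_rfl) (fun n hn ↦ hqN n hn _ (by lia))
    rw [← quasiIsoAt_iff_comp_right _ (π N), hf]
    exact hN N le_rfl j (by lia)

end CochainComplex

/-! ### Lifting cocycles: from residue fields to all modules. -/

section LiftsCocycles

variable {R : Type u} [CommRing R] {A B D E : Type u} [AddCommGroup A] [Module R A]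
  [AddCommGroup B] [Module R B] [AddCommGroup D] [Module R D] [AddCommGroup E] [Module R E]

/-- Every linear map from `N` to the kernel of `ε` factors through `δ`. When `δ` and `ε` are
consecutive differentials of a semi-injective complex, this is the vanishing of an `Ext` module. -/
def LiftsCocycles (δ : A →ₗ[R] B) (ε : B →ₗ[R] D) (N : Type u) [AddCommGroup N] [Module R N] :
    Prop :=
  ∀ f : N →ₗ[R] B, ε ∘ₗ f = 0 → ∃ g : N →ₗ[R] A, δ ∘ₗ g = f

variable {δ : A →ₗ[R] B} {ε : B →ₗ[R] D} {N P Q : Type u} [AddCommGroup N] [Module R N]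
  [AddCommGroup P] [Module R P] [AddCommGroup Q] [Module R Q]

/-- A variant of Eklof's lemma: cocycles on `N` lift if every nonzero quotient of `N` contains a
cyclic submodule on which cocycles lift. -/
theorem LiftsCocycles.of_quotients [Module.Injective R A] (hεδ : ε ∘ₗ δ = 0)
    (hN : ∀ N' : Submodule R N, N' ≠ ⊤ → ∃ x : N ⧸ N', x ≠ 0 ∧
      LiftsCocycles δ ε (R ⧸ LinearMap.ker (LinearMap.toSpanSingleton R (N ⧸ N') x))) :
    LiftsCocycles δ ε N := by
  intro f hf
  let S : Set (N →ₗ.[R] A) := { g | ∀ x : g.domain, δ (g x) = f x }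
  obtain ⟨g, hg⟩ : ∃ g, Maximal (· ∈ S) g := by
    refine zorn_le₀ S fun c hcS hc ↦ ?_
    obtain rfl | hne := c.eq_empty_or_nonempty
    · exact ⟨⊥, fun x ↦ by
        obtain ⟨x, hx⟩ := x
        obtain rfl : x = 0 := (Submodule.mem_bot R).1 hx
        simp [show (⟨0, hx⟩ : (⊥ : N →ₗ.[R] A).domain) = 0 from rfl], by simp⟩
    · refine ⟨LinearPMap.sSup c hc.directedOn, fun ⟨x, hx⟩ ↦ ?_,
        fun l hl ↦ LinearPMap.le_sSup hc.directedOn hl⟩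
      obtain ⟨l, hl, hxl⟩ := (LinearPMap.mem_domain_sSup_iff hne hc.directedOn).1 hx
      rw [LinearPMap.sSup_apply hc.directedOn hl ⟨x, hxl⟩]
      exact hcS hl ⟨x, hxl⟩
  obtain ⟨G, hG⟩ := Module.Injective.out g.domain.subtype g.domain.injective_subtype g.toFun
  by_cases htop : g.domain = ⊤
  · exact ⟨G, LinearMap.ext fun x ↦ by
      have hx : x ∈ g.domain := htop ▸ Submodule.mem_top
      have := hG ⟨x, hx⟩
      rw [Submodule.subtype_apply] at this
      rw [LinearMap.comp_apply, this]
      exact hg.1 ⟨x, hx⟩⟩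
  exfalso
  obtain ⟨x, hx0, hx⟩ := hN g.domain htop
  -- The error of the extension `G` descends to the quotient; correcting it on the cyclic submodule
  -- generated by `x` will contradict maximality.
  let e : N ⧸ g.domain →ₗ[R] B := g.domain.liftQ (f - δ ∘ₗ G) fun y hy ↦ by
    have := hG ⟨y, hy⟩
    rw [Submodule.subtype_apply] at this
    rw [LinearMap.mem_ker, LinearMap.sub_apply, LinearMap.comp_apply, this, sub_eq_zero]
    exact (hg.1 ⟨y, hy⟩).symm
  have he : ε ∘ₗ e = 0 := by
    refine Submodule.linearMap_qext _ (LinearMap.ext fun y ↦ ?_)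
    have h₁ := LinearMap.congr_fun hf y
    have h₂ := LinearMap.congr_fun hεδ (G y)
    simp only [LinearMap.comp_apply, LinearMap.zero_apply] at h₁ h₂
    simp [e, h₁, h₂]
  let j : (R ⧸ LinearMap.ker (LinearMap.toSpanSingleton R (N ⧸ g.domain) x)) →ₗ[R] N ⧸ g.domain :=
    Submodule.liftQ _ (LinearMap.toSpanSingleton R (N ⧸ g.domain) x) le_rfl
  have hj : Function.Injective j := by
    rw [← LinearMap.ker_eq_bot]
    exact Submodule.ker_liftQ_eq_bot _ _ _ le_rfl
  obtain ⟨h, hh⟩ := hx (e ∘ₗ j) (by rw [← LinearMap.comp_assoc, he, LinearMap.zero_comp])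
  obtain ⟨h', hh'⟩ := Module.Injective.out j hj h
  let G' : N →ₗ[R] A := G + h' ∘ₗ g.domain.mkQ
  let g' : N →ₗ.[R] A := ⟨LinearMap.eqLocus (δ ∘ₗ G') f, G'.domRestrict _⟩
  have hg' : g' ∈ S := fun y ↦ y.2
  have hG'g (y : g.domain) : G' y = g y := by
    simp only [G', LinearMap.add_apply, LinearMap.comp_apply, Submodule.mkQ_apply]
    rw [(Submodule.Quotient.mk_eq_zero _).2 y.2, map_zero, add_zero]
    exact hG y
  have hle : g ≤ g' := by
    refine ⟨fun y hy ↦ ?_, fun y z hyz ↦ ?_⟩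
    · change δ (G' y) = f y
      rw [hG'g ⟨y, hy⟩]
      exact hg.1 ⟨y, hy⟩
    · change g y = G' z
      rw [← hyz, hG'g]
  obtain ⟨y, rfl⟩ := Submodule.Quotient.mk_surjective _ x
  have hy : y ∈ g'.domain := by
    change δ (G' y) = f y
    have h₁ := hh' (Submodule.Quotient.mk 1)
    have h₂ := LinearMap.congr_fun hh (Submodule.Quotient.mk 1)
    have h₃ : j (Submodule.Quotient.mk 1) = Submodule.Quotient.mk y :=
      one_smul R (Submodule.Quotient.mk y : N ⧸ g.domain)
    rw [LinearMap.comp_apply, LinearMap.comp_apply, h₃] at h₂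
    rw [h₃] at h₁
    have h₄ : e (Submodule.Quotient.mk y) = f y - δ (G y) := rfl
    simp only [G', LinearMap.add_apply, LinearMap.comp_apply, Submodule.mkQ_apply]
    rw [h₁, map_add, h₂, h₄, add_sub_cancel]
  exact hx0 ((Submodule.Quotient.mk_eq_zero _).2 ((hg.2 hg' hle).1 hy))

/-- Lifting of cocycles passes to kernels of surjections, with a shift of degrees. -/
theorem LiftsCocycles.of_exact [Module.Injective R B] {ζ : D →ₗ[R] E}
    (hζε : ζ ∘ₗ ε = 0) {i : N →ₗ[R] P} {π : P →ₗ[R] Q} (hi : Function.Injective i)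
    (hπ : Function.Surjective π) (hiπ : LinearMap.ker π = LinearMap.range i)
    (hP : LiftsCocycles δ ε P) (hQ : LiftsCocycles ε ζ Q) : LiftsCocycles δ ε N := by
  intro f hf
  obtain ⟨F, hF⟩ := Module.Injective.out i hi f
  -- The connecting map: `ε ∘ₗ F` kills `N`, hence is a cocycle on `Q`. Subtracting a lift of it
  -- makes `F` a cocycle on `P`.
  let e : P ⧸ LinearMap.ker π →ₗ[R] D := Submodule.liftQ _ (ε ∘ₗ F) (by
    rw [hiπ]
    rintro _ ⟨y, rfl⟩
    rw [LinearMap.mem_ker, LinearMap.comp_apply, hF]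
    exact LinearMap.congr_fun hf y)
  let φ := LinearMap.quotKerEquivOfSurjective π hπ
  have he (y : P) : e (φ.symm (π y)) = ε (F y) := by
    have : φ.symm (π y) = Submodule.Quotient.mk y := by
      rw [LinearEquiv.symm_apply_eq]; rfl
    rw [this]; rfl
  obtain ⟨h, hh⟩ := hQ (e ∘ₗ φ.symm.toLinearMap) (LinearMap.ext fun y ↦ by
    obtain ⟨y, rfl⟩ := hπ y
    change ζ (e (φ.symm (π y))) = 0
    rw [he]
    exact LinearMap.congr_fun hζε _)
  have hh' (y : P) : ε (h (π y)) = ε (F y) := by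
    rw [← he]
    exact LinearMap.congr_fun hh (π y)
  obtain ⟨k, hk⟩ := hP (F - h ∘ₗ π) (LinearMap.ext fun y ↦ by simp [hh'])
  refine ⟨k ∘ₗ i, LinearMap.ext fun y ↦ ?_⟩
  have h₁ := LinearMap.congr_fun hk (i y)
  have h₂ : π (i y) = 0 := by
    rw [← LinearMap.mem_ker, hiπ]
    exact ⟨y, rfl⟩
  simpa [h₂, hF] using h₁

theorem exists_isPrime_ker_toSpanSingleton [IsNoetherianRing R] [Nontrivial N] :
    ∃ x : N, x ≠ 0 ∧ Ideal.IsPrime (LinearMap.ker (LinearMap.toSpanSingleton R N x)) := by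
  obtain ⟨p, hp⟩ := associatedPrimes.nonempty R N
  obtain ⟨hp, x, rfl⟩ := isAssociatedPrime_iff.1 hp
  have hx : LinearMap.ker (LinearMap.toSpanSingleton R N x) = (⊥ : Submodule R N).colon {x} := by
    ext r
    simp [Submodule.mem_colon_singleton]
  refine ⟨x, ?_, hx ▸ hp⟩
  rintro rfl
  exact hp.ne_top (by rw [← hx]; simp)

theorem LiftsCocycles.of_forall_prime [IsNoetherianRing R] [Module.Injective R A]
    (hεδ : ε ∘ₗ δ = 0) (h : ∀ (q : Ideal R) [q.IsPrime], LiftsCocycles δ ε (R ⧸ q)) :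
    LiftsCocycles δ ε N :=
  .of_quotients hεδ fun N' hN' ↦ by
    have := Submodule.Quotient.nontrivial_iff.2 hN'
    obtain ⟨x, hx, _⟩ := exists_isPrime_ker_toSpanSingleton (R := R) (N := N ⧸ N')
    exact ⟨x, hx, h _⟩

/-- Cocycles on the residue field modulo the image of `R ⧸ p` lift as soon as they lift on `R ⧸ q`
for all primes `q` strictly containing `p`. -/
theorem LiftsCocycles.residueField_quotient [IsNoetherianRing R] [Module.Injective R A]
    (hεδ : ε ∘ₗ δ = 0) (p : Ideal R) [p.IsPrime]
    (h : ∀ (q : Ideal R) [q.IsPrime], p < q → LiftsCocycles δ ε (R ⧸ q)) :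
    LiftsCocycles δ ε
      (p.ResidueField ⧸
        LinearMap.range (IsScalarTower.toAlgHom R (R ⧸ p) p.ResidueField).toLinearMap) := by
  refine .of_quotients hεδ fun N' hN' ↦ ?_
  have := Submodule.Quotient.nontrivial_iff.2 hN'
  obtain ⟨x, hx, _⟩ := exists_isPrime_ker_toSpanSingleton (R := R) (N := _ ⧸ N')
  refine ⟨x, hx, h _ ?_⟩
  obtain ⟨y, rfl⟩ := Submodule.Quotient.mk_surjective _ x
  obtain ⟨y, rfl⟩ := Submodule.Quotient.mk_surjective _ y
  have hle : p ≤ LinearMap.ker (LinearMap.toSpanSingleton R (_ ⧸ N')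
      (Submodule.Quotient.mk (Submodule.Quotient.mk y))) := fun r hr ↦ by
    have : r • y = 0 := by
      rw [Algebra.smul_def, Ideal.algebraMap_residueField_eq_zero.2 hr, zero_mul]
    rw [LinearMap.mem_ker, LinearMap.toSpanSingleton_apply, ← Submodule.Quotient.mk_smul,
      ← Submodule.Quotient.mk_smul, this]
    simp
  refine lt_of_le_of_ne hle fun heq ↦ ?_
  -- For `y = a / s`, the denominator `s ∉ p` kills the class of `y`, because `s • y = a` lies in
  -- the image of `R ⧸ p`.
  obtain ⟨a, s, hs, rfl⟩ := IsFractionRing.div_surjective (A := R ⧸ p) y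
  obtain ⟨s, rfl⟩ := Ideal.Quotient.mk_surjective s
  obtain ⟨a, rfl⟩ := Ideal.Quotient.mk_surjective a
  have hs' : s ∉ p := fun hsp ↦ nonZeroDivisors.ne_zero hs (Ideal.Quotient.eq_zero_iff_mem.2 hsp)
  apply hs'
  rw [heq, LinearMap.mem_ker, LinearMap.toSpanSingleton_apply, ← Submodule.Quotient.mk_smul,
      ← Submodule.Quotient.mk_smul, Submodule.Quotient.mk_eq_zero]
  convert N'.zero_mem
  rw [Submodule.Quotient.mk_eq_zero]
  refine ⟨Ideal.Quotient.mk p a, ?_⟩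
  have hs0 : algebraMap (R ⧸ p) p.ResidueField (Ideal.Quotient.mk p s) ≠ 0 :=
    IsFractionRing.to_map_ne_zero_of_mem_nonZeroDivisors hs
  have : s • (algebraMap (R ⧸ p) p.ResidueField (Ideal.Quotient.mk p a) /
      algebraMap (R ⧸ p) p.ResidueField (Ideal.Quotient.mk p s)) =
      algebraMap (R ⧸ p) p.ResidueField (Ideal.Quotient.mk p a) := by
    rw [Algebra.smul_def, IsScalarTower.algebraMap_apply R (R ⧸ p) p.ResidueField]
    exact mul_div_cancel₀ _ hs0
  rw [this]
  rfl

end LiftsCocycles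

/-- Over a noetherian ring, if cocycles of degree greater than `d` on all residue fields lift in a
complex of injective modules, then so do those on all modules. -/
theorem liftsCocycles_of_residueField {R : Type u} [CommRing R] [IsNoetherianRing R]
    {I : ℤ → Type u} [∀ i, AddCommGroup (I i)] [∀ i, Module R (I i)] [∀ i, Module.Injective R (I i)]
    (δ : ∀ i, I i →ₗ[R] I (i + 1)) (hδ : ∀ i, δ (i + 1) ∘ₗ δ i = 0) (d : ℤ)
    (h : ∀ (p : Ideal R) [p.IsPrime] (i : ℤ), d ≤ i →
      LiftsCocycles (δ i) (δ (i + 1)) p.ResidueField) (i : ℤ) (hi : d ≤ i)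
    (N : Type u) [AddCommGroup N] [Module R N] :
    LiftsCocycles (δ i) (δ (i + 1)) N := by
  refine .of_forall_prime (hδ i) fun q _ ↦ ?_
  -- The degree must vary: larger primes are used in degree `i + 1`.
  induction q using WellFoundedGT.induction generalizing i with
  | ind p ih =>
  let φ := (IsScalarTower.toAlgHom R (R ⧸ p) p.ResidueField).toLinearMap
  exact .of_exact (hδ (i + 1)) (i := φ) (π := (LinearMap.range φ).mkQ)
    (IsFractionRing.injective (R ⧸ p) p.ResidueField) (Submodule.mkQ_surjective _)
    (Submodule.ker_mkQ _) (h p i hi)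
    (.residueField_quotient (hδ (i + 1)) p fun q _ hq ↦ ih q hq (i + 1) (by lia) ‹_›)

/-! ### Truncating a complex of injectives. -/

namespace CochainComplex

open HomologicalComplex HomComplex

section

variable {C : Type*} [Category C] [Abelian C]

/-- If all cocycles of degree greater than `d` of a complex of injectives lift, then the complex is
homotopy equivalent to a complex of injectives concentrated in degrees at most `d`. -/
theorem exists_homotopyEquiv_of_lifts (I : CochainComplex C ℤ) [∀ i, Injective (I.X i)] (d : ℤ)
    (h : ∀ a b : ℤ, a + 1 = b → d ≤ a → ∀ {N : C} (f : N ⟶ I.X b), f ≫ I.d b (b + 1) = 0 →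
      ∃ g : N ⟶ I.X a, g ≫ I.d a b = f) :
    ∃ J : CochainComplex C ℤ, Nonempty (HomotopyEquiv I J) ∧ (∀ i, Injective (J.X i)) ∧
      ∀ i, d < i → IsZero (J.X i) := by
  have hu (b a : ℤ) (hab : a + 1 = b) : ∃ u : I.X b ⟶ I.X a,
      (d ≤ a → ∀ {N : C} (f : N ⟶ I.X b), f ≫ I.d b (b + 1) = 0 → f ≫ u ≫ I.d a b = f) ∧
        (a < d → u = 0) := by
    by_cases hd : d ≤ a
    · obtain ⟨s, hs⟩ := h a b hab hd (kernel.ι (I.d b (b + 1))) (kernel.condition _)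
      refine ⟨Injective.factorThru s (kernel.ι (I.d b (b + 1))), fun _ N f hf ↦ ?_, by lia⟩
      rw [← kernel.lift_ι _ f hf, Category.assoc, Injective.comp_factorThru_assoc, hs]
    · exact ⟨0, by lia, fun _ ↦ rfl⟩
  choose u hu hu₀ using hu
  -- The factor `𝟙 - d ≫ u` lands in cocycles, which makes `H` a contraction above degree `d`.
  let H (b a : ℤ) (hab : a + 1 = b) : I.X b ⟶ I.X a :=
    (𝟙 _ - I.d b (b + 1) ≫ u (b + 1) b rfl) ≫ u b a hab
  have hH₀ (b a : ℤ) (hab : a + 1 = b) (ha : a < d) : H b a hab = 0 := by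
    simp [H, hu₀ b a hab ha]
  have hHd (b a : ℤ) (hab : a + 1 = b) (ha : d ≤ a) :
      H b a hab ≫ I.d a b = 𝟙 _ - I.d b (b + 1) ≫ u (b + 1) b rfl := by
    rw [Category.assoc]
    refine hu b a hab ha _ ?_
    rw [Preadditive.sub_comp, Category.id_comp, Category.assoc,
      hu (b + 1) b rfl (by lia) _ (I.d_comp_d _ _ _), sub_self]
  have hdH (b a : ℤ) (hab : a + 1 = b) : I.d a b ≫ H b a hab = I.d a b ≫ u b a hab := by
    simp [H]
  -- This idempotent is the identity below `d`, zero above, and in degree `d` projects onto the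
  -- cocycles; its image is the truncation.
  let e : I ⟶ I := 𝟙 I - Homotopy.nullHomotopicMap' H
  have he (i : ℤ) : e.f i = 𝟙 _ - (I.d i (i + 1) ≫ H (i + 1) i rfl +
      H i (i - 1) (by lia) ≫ I.d (i - 1) i) := by
    simp only [e, sub_f_apply, id_f]
    exact congrArg (𝟙 (I.X i) - ·) (Homotopy.nullHomotopicMap'_f (c := .up ℤ) (k₂ := i - 1)
      (k₁ := i) (k₀ := i + 1) (by simp) (by simp) H)
  have he₀ (i : ℤ) (hi : d < i) : e.f i = 0 := by
    rw [he, hHd i (i - 1) (by lia) (by lia), hdH]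
    abel
  have he₁ (i : ℤ) (hi : i ≤ d) : e.f i = 𝟙 _ - I.d i (i + 1) ≫ u (i + 1) i rfl := by
    rw [he, hH₀ i (i - 1) (by lia) (by lia), hdH]
    simp
  have hee : e ≫ e = e := by
    ext i : 1
    rw [comp_f]
    obtain hi | hi | hi := lt_trichotomy i d
    · rw [he₁ i hi.le, hu₀ _ _ _ hi]
      simp
    · rw [he₁ i hi.le]
      have := hu (i + 1) i rfl hi.ge (I.d i (i + 1)) (I.d_comp_d _ _ _)
      simp [reassoc_of% this]
    · rw [he₀ i hi, comp_zero]
  obtain ⟨J, s, r, hsr, hrs⟩ := IsIdempotentComplete.idempotents_split I e hee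
  have hsr' (i : ℤ) : s.f i ≫ r.f i = 𝟙 _ := by rw [← comp_f, hsr, id_f]
  refine ⟨J, ⟨⟨r, s, ?_, Homotopy.ofEq hsr⟩⟩, fun i ↦ ?_, fun i hi ↦ ?_⟩
  · refine (Homotopy.equivSubZero.symm ?_).symm
    exact (Homotopy.ofEq (by rw [hrs]; simp [e])).trans (Homotopy.nullHomotopy' H)
  · exact Retract.injective (Y := I.X i) ⟨s.f i, r.f i, hsr' i⟩
  · rw [IsZero.iff_id_eq_zero, ← hsr', ← Category.comp_id (r.f i), ← hsr' i]
    have : r.f i ≫ s.f i = 0 := by rw [← comp_f, hrs, he₀ i hi]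
    rw [reassoc_of% this, zero_comp, comp_zero]

lemma exists_lift_of_subsingleton_cohomologyClass {I : CochainComplex C ℤ} {N : C} {a b : ℤ}
    (hab : a + 1 = b) (h : Subsingleton (CohomologyClass ((singleFunctor C 0).obj N) I b))
    (f : N ⟶ I.X b) (hf : f ≫ I.d b (b + 1) = 0) : ∃ g : N ⟶ I.X a, g ≫ I.d a b = f := by
  rw [← Cocycle.fromSingleMk_mem_coboundaries_iff f (zero_add b) (b + 1) rfl hf a hab,
    ← CohomologyClass.mk_eq_zero_iff]
  exact h.elim _ _

lemma subsingleton_cohomologyClass [HasDerivedCategory C] {K M I : CochainComplex C ℤ} (f : M ⟶ I)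
    [QuasiIso f] [I.IsKInjective] (n : ℤ)
    (h : Subsingleton (ShiftedHom (DerivedCategory.Q.obj K) (DerivedCategory.Q.obj M) n)) :
    Subsingleton (CohomologyClass K I n) := by
  let e : DerivedCategory.Qh.obj ((HomotopyCategory.quotient C (.up ℤ)).obj (I⟦n⟧)) ≅
      (DerivedCategory.Q.obj M)⟦n⟧ :=
    (DerivedCategory.quotientCompQhIso C).app (I⟦n⟧) ≪≫
      (DerivedCategory.Q.commShiftIso n).app I ≪≫
      (CategoryTheory.shiftFunctor (DerivedCategory C) n).mapIso (asIso (DerivedCategory.Q.map f)).symm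
  have : Subsingleton (DerivedCategory.Qh.obj ((HomotopyCategory.quotient C (.up ℤ)).obj K) ⟶
      DerivedCategory.Qh.obj ((HomotopyCategory.quotient C (.up ℤ)).obj (I⟦n⟧))) :=
    (((DerivedCategory.quotientCompQhIso C).app K).homCongr e).subsingleton_congr.2 h
  exact (((CochainComplex.IsKInjective.Qh_map_bijective _ _).comp
    (CohomologyClass.toHom_bijective K I n)).injective).subsingleton

end

/-- Over a noetherian ring, if the cohomology of `Hom(k(p), I)` vanishes in degrees greater than `d`
for all primes `p`, where `I` is a complex of injectives, then that of `Hom(N, I)` vanishes in these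
degrees for all modules `N`. -/
theorem exists_lift_of_residueModule {R : Type u} [CommRing R] [IsNoetherianRing R]
    (I : CochainComplex (ModuleCat.{u} R) ℤ) [∀ i, Injective (I.X i)] (d : ℤ)
    (h : ∀ (p : Ideal R) [p.IsPrime] (i : ℤ), d < i → Subsingleton
      (CohomologyClass ((singleFunctor (ModuleCat.{u} R) 0).obj (residueModule R p)) I i))
    (a b : ℤ) (hab : a + 1 = b) (ha : d ≤ a) {N : ModuleCat.{u} R} (f : N ⟶ I.X b)
    (hf : f ≫ I.d b (b + 1) = 0) : ∃ g : N ⟶ I.X a, g ≫ I.d a b = f := by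
  subst hab
  have (i : ℤ) : Module.Injective R (I.X i) :=
    Module.injective_module_of_injective_object (inj := inferInstanceAs (Injective (I.X i))) R _
  obtain ⟨g, hg⟩ := liftsCocycles_of_residueField (R := R) (I := fun i ↦ I.X i)
    (fun i ↦ (I.d i (i + 1)).hom)
    (fun i ↦ by rw [← ModuleCat.hom_comp, I.d_comp_d, ModuleCat.hom_zero]) d
    (fun p _ i hi f hf ↦ by
      obtain ⟨g, hg⟩ := exists_lift_of_subsingleton_cohomologyClass rfl
        (h p (i + 1) (by lia)) (ModuleCat.ofHom f) (ModuleCat.hom_ext hf)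
      exact ⟨g.hom, by rw [← ModuleCat.hom_comp, hg, ModuleCat.hom_ofHom]⟩) a ha N f.hom
    (by rw [← ModuleCat.hom_comp, hf, ModuleCat.hom_zero])
  exact ⟨ModuleCat.ofHom g, ModuleCat.hom_ext hg⟩

end CochainComplex

/-! ### Injectivity of modules and the main theorem. -/

/-- An object is injective if cocycles of degree one lift in an injective resolution. -/
lemma CategoryTheory.InjectiveResolution.injective_of_lifts {C : Type*} [Category C] [Abelian C]
    {X : C} (J : InjectiveResolution X)
    (h : ∀ {N : C} (f : N ⟶ J.cocomplex.X 1), f ≫ J.cocomplex.d 1 2 = 0 →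
      ∃ g : N ⟶ J.cocomplex.X 0, g ≫ J.cocomplex.d 0 1 = f) : Injective X := by
  obtain ⟨s, hs⟩ := h (kernel.ι (J.cocomplex.d 1 2)) (kernel.condition _)
  -- `t` kills the differential and fixes `X`, so it is a retraction onto `X`.
  let t : J.cocomplex.X 0 ⟶ J.cocomplex.X 0 :=
    𝟙 _ - kernel.lift (J.cocomplex.d 1 2) (J.cocomplex.d 0 1) (J.cocomplex.d_comp_d _ _ _) ≫ s
  have ht : t ≫ J.cocomplex.d 0 1 = 0 := by
    simp [t, hs]
  let ι : X ⟶ J.cocomplex.X 0 := J.ι.f 0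
  have : Mono ι := inferInstanceAs (Mono (J.ι.f 0))
  have hι : ι ≫ J.cocomplex.d 0 1 = 0 := J.ι_f_zero_comp_complex_d
  obtain ⟨r, hr⟩ : ∃ r : J.cocomplex.X 0 ⟶ X, r ≫ ι = t :=
    ⟨_, (KernelFork.IsLimit.lift' J.isLimitKernelFork t ht).2⟩
  refine Retract.injective (Y := J.cocomplex.X 0) ⟨ι, r, ?_⟩
  have : ι ≫ kernel.lift (J.cocomplex.d 1 2) (J.cocomplex.d 0 1)
      (J.cocomplex.d_comp_d _ _ _) = 0 := by
    rw [← cancel_mono (kernel.ι _), Category.assoc, kernel.lift_ι, hι, zero_comp]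
  rw [← cancel_mono ι, Category.assoc, hr]
  simp [t, reassoc_of% this]

theorem theorem1p1 (R : Type u) [CommRing R] [IsNoetherianRing R] :
    (∀ (M : CochainComplex (ModuleCat.{u} R) ℤ) (d : ℤ),
      (∀ (p : Ideal R) [p.IsPrime] (i : ℤ), d < i →
        Subsingleton
          (cplxExt ((CochainComplex.singleFunctor (ModuleCat.{u} R) 0).obj (residueModule R p))
            M i)) →
      HasInjDimLE M d) ∧
    (∀ (M : Type u) [AddCommGroup M] [Module R M],
      (∀ (p : Ideal R) [p.IsPrime] (i : ℕ), 1 ≤ i →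
        Subsingleton (Abelian.Ext.{u} (residueModule R p) (ModuleCat.of R M) i)) →
      Module.Injective R M) := by
  refine ⟨fun M d h ↦ ?_, fun M _ _ h ↦ ?_⟩
  · obtain ⟨I, f, hI, _, _⟩ := CochainComplex.exists_isKInjective_resolution M
    let := HasDerivedCategory.standard (ModuleCat.{u} R)
    obtain ⟨J, ⟨e⟩, hJ, hJ'⟩ := CochainComplex.exists_homotopyEquiv_of_lifts I d
      (fun a b hab ha _ ↦ CochainComplex.exists_lift_of_residueModule I d
        (fun p _ i hi ↦ CochainComplex.subsingleton_cohomologyClass f i (h p i hi)) a b hab ha)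
    have : QuasiIso e.hom := e.quasiIso_hom
    exact ⟨J, f ≫ e.hom, ⟨hJ, e.isKInjective⟩, inferInstance, hJ'⟩
  · let J := InjectiveResolution.of (ModuleCat.of R M)
    have hJ := InjectiveResolution.injective_of_lifts J fun {N} f hf ↦ by
      obtain ⟨g, hg⟩ := CochainComplex.exists_lift_of_residueModule J.cochainComplex 0
        (fun p _ i hi ↦ by
          obtain ⟨i, rfl⟩ := Int.eq_ofNat_of_zero_le hi.le
          exact J.extEquivCohomologyClass.symm.subsingleton_congr.2 (h p i (by lia)))
        0 1 rfl le_rfl (f ≫ (J.cochainComplexXIso 1 1 rfl).inv) (by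
          rw [J.cochainComplex_d 1 (1 + 1) 1 2 rfl rfl]
          simp [reassoc_of% hf])
      refine ⟨g ≫ (J.cochainComplexXIso 0 0 rfl).hom, ?_⟩
      rw [← cancel_mono (J.cochainComplexXIso 1 1 rfl).inv, ← hg,
        J.cochainComplex_d 0 1 0 1 rfl rfl]
      simp
    exact Module.injective_module_of_injective_object R M
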